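/- For a partition $\pi=(\lambda_1\ge\lambda_2\ge\dots\ge\lambda_r)$ of a positive integer $n$, the Ferrers board of $\pi$ consists of left-justified rows of $\lambda_1,\dots,\lambda_r$ unit squares, from top to bottom. The max-rook number $R(\pi)$ is the maximal number of rooks that can be placed on the Ferrers board of $\pi$ so that no two of them lie in the same row or in the same column. Let $R_5(n)$ be the number of partitions $\pi$ of $n$ with $R(\pi)=5$. The Durfee triangle of $\pi$ is the largest right-angled isosceles triangle with its right angle at the top-left node that is contained in the Ferrers diagram of $\pi$; its size is the number $k$ of nodes on each leg (so that it consists of rows of $k,k-1,\dots,1$ nodes). **Theorem.** For every complex number $q$ with $|q|<1$, the series $\sum_{n\ge 1}R_5(n)q^n$ converges and $$\sum_{n=1}^{\infty}R_5(n)q^n=\frac{q^{15}\,N(q)}{(1-q)^2(1-q^3)(1-q^4)(1-q^5)},$$ where $$\begin{aligned}N(q)={}&1+4q+6q^2+8q^3+8q^4+4q^5+4q^6-5q^7-5q^8-10q^9-7q^{10}-5q^{11}\\&+4q^{13}+6q^{14}+7q^{15}+2q^{17}-4q^{18}-q^{19}-q^{20}-q^{21}+q^{22}-q^{23}+q^{24}.\end{aligned}$$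 The same holds with $R_5(n)$ replaced by the number of partitions of $n$ with a Durfee triangle of size $5$. -/

import Mathlib

namespace RookPartition

/-- The Ferrers board of a partition `π` of `n` (drawn with nonnegative coordinates, rows going
downwards): the square `(i, j)` belongs to the board iff `j < λᵢ`, where `λ₀ ≥ λ₁ ≥ ⋯` are the
parts of `π`. -/
def ferrersBoard {n : ℕ} (π : n.Partition) : YoungDiagram :=
  YoungDiagram.ofRowLens (π.parts.sort (· ≥ ·)) (Multiset.pairwise_sort π.parts (· ≥ ·)).sortedGE

/-- A set of squares is a placement of non-intersecting rooks if no two distinct squares of it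
share a row or a column. -/
def NonIntersecting (S : Finset (ℕ × ℕ)) : Prop :=
  ∀ a ∈ S, ∀ b ∈ S, a ≠ b → a.1 ≠ b.1 ∧ a.2 ≠ b.2

instance (S : Finset (ℕ × ℕ)) : Decidable (NonIntersecting S) :=
  inferInstanceAs (Decidable (∀ a ∈ S, ∀ b ∈ S, a ≠ b → a.1 ≠ b.1 ∧ a.2 ≠ b.2))

/-- The max-rook number `R(π)`: the maximal number of non-intersecting rooks that can be placed in
the Ferrers board of `π`. -/
def maxRook {n : ℕ} (π : n.Partition) : ℕ :=
  ((ferrersBoard π).cells.powerset.filter (fun S => NonIntersecting S)).sup Finset.card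

/-- The right-angled isosceles triangle with `k` nodes on each leg and its right angle at the
top-left node. -/
def triangle (k : ℕ) : Finset (ℕ × ℕ) :=
  (Finset.range k ×ˢ Finset.range k).filter (fun c => c.1 + c.2 < k)

/-- The size of the Durfee triangle of `π`: the largest `k` such that the triangle of size `k` is
contained in the Ferrers diagram. The search bound `n` is no restriction, as a triangle of size `k`
has at least `k` nodes and the diagram has `n`. -/
def durfeeTriangleSize {n : ℕ} (π : n.Partition) : ℕ :=
  Nat.findGreatest (fun k => triangle k ⊆ (ferrersBoard π).cells) n

/-- `R_k(n)`: the number of partitions of `n` with max-rook number `k`. -/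
def rookCount (k n : ℕ) : ℕ :=
  (Finset.univ.filter (fun π : n.Partition => maxRook π = k)).card

/-- The number of partitions of `n` with a Durfee triangle of size `k`. -/
def durfeeCount (k n : ℕ) : ℕ :=
  (Finset.univ.filter (fun π : n.Partition => durfeeTriangleSize π = k)).card

/-- The explicit rational function of the theorem. -/
noncomputable def rationalF5 (q : ℂ) : ℂ :=
  q ^ 15 / ((1 - q) ^ 2 * (1 - q ^ 3) * (1 - q ^ 4) * (1 - q ^ 5)) *
    (1 + 4 * q + 6 * q ^ 2 + 8 * q ^ 3 + 8 * q ^ 4 + 4 * q ^ 5 + 4 * q ^ 6 - 5 * q ^ 7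
      - 5 * q ^ 8 - 10 * q ^ 9 - 7 * q ^ 10 - 5 * q ^ 11 + 4 * q ^ 13 + 6 * q ^ 14 + 7 * q ^ 15
      + 2 * q ^ 17 - 4 * q ^ 18 - q ^ 19 - q ^ 20 - q ^ 21 + q ^ 22 - q ^ 23 + q ^ 24)

end RookPartition

namespace RookPartition

open PowerSeries

/-! The two counts agree because the max-rook number equals the size of the Durfee triangle
(`le_maxRook_iff`). The hypotenuse of a triangle of size `k` carries `k` rooks. If a hypotenuse
square is missing from the board, the board is covered by `k - 1` rows and columns in total.

For the series, split by the last column `m + 1` in which the triangle of size `k + 1` fails to fit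
(`mem_durfeeSet_iff`). Exactly `k - m` parts exceed `m`, and all of these are at least `m + 2`. The
conditions on them and on the parts at most `m` are independent (`durfeeLayer_eq`). Removing extreme
parts one at a time gives a recursion for each family (`absEval_topSet`, `absEval_stackedSet`).
Every recursion has finite depth, so each layer sums to an explicit rational function. For `k = 5`
the six layers add up to the stated one (`layerSum_five`). -/

/-- The power series `f` converges absolutely at `q`, with sum `x`. -/
def AbsEval (q : ℂ) (f : ℂ⟦X⟧) (x : ℂ) : Prop :=
  Summable (fun n => ‖coeff n f * q ^ n‖) ∧ ∑' n, coeff n f * q ^ n = x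

/-! ### Algebra of absolutely convergent evaluations -/

namespace AbsEval

variable {q x y : ℂ} {f g : ℂ⟦X⟧}

theorem hasSum (hf : AbsEval q f x) : HasSum (fun n => coeff n f * q ^ n) x := by
  have h := hf.1.of_norm.hasSum
  rwa [hf.2] at h

theorem add (hf : AbsEval q f x) (hg : AbsEval q g y) : AbsEval q (f + g) (x + y) := by
  have e : (fun n => coeff n (f + g) * q ^ n) =
      fun n => coeff n f * q ^ n + coeff n g * q ^ n := by
    funext n
    simp [add_mul]
  refine ⟨?_, ?_⟩
  · refine Summable.of_nonneg_of_le (fun n => norm_nonneg _) (fun n => ?_) (hf.1.add hg.1)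
    rw [congrFun e n]
    exact norm_add_le _ _
  · rw [e]
    exact (hf.hasSum.add hg.hasSum).tsum_eq

theorem mul (hf : AbsEval q f x) (hg : AbsEval q g y) : AbsEval q (f * g) (x * y) := by
  have e : (fun n => coeff n (f * g) * q ^ n) = fun n => ∑ kl ∈ Finset.HasAntidiagonal.antidiagonal n,
      (coeff kl.1 f * q ^ kl.1) * (coeff kl.2 g * q ^ kl.2) := by
    funext n
    rw [coeff_mul, Finset.sum_mul]
    refine Finset.sum_congr rfl fun kl hkl => ?_
    rw [← Finset.HasAntidiagonal.mem_antidiagonal.1 hkl, pow_add]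
    ring
  refine ⟨?_, ?_⟩
  · have := summable_norm_sum_mul_antidiagonal_of_summable_norm hf.1 hg.1
    exact this.congr fun n => by rw [congrFun e n]
  · rw [e, ← tsum_mul_tsum_eq_tsum_sum_antidiagonal_of_summable_norm hf.1 hg.1, hf.2, hg.2]

theorem X_pow (a : ℕ) : AbsEval q (X ^ a) (q ^ a) := by
  have h0 : ∀ n, n ≠ a → coeff n (X ^ a : ℂ⟦X⟧) * q ^ n = 0 := fun n hn => by
    rw [coeff_X_pow, if_neg hn, zero_mul]
  refine ⟨summable_of_ne_finset_zero (s := {a}) fun n hn => ?_, ?_⟩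
  · rw [h0 n (by simpa using hn), norm_zero]
  · rw [tsum_eq_single a h0]
    simp

theorem zero : AbsEval q 0 0 := by
  simp [AbsEval]

theorem one : AbsEval q 1 1 := by
  simpa using X_pow (q := q) 0

/-- The indicator series of the multiples of `a`, the expansion of `1 / (1 - X ^ a)`. -/
noncomputable def geomSeries (a : ℕ) : ℂ⟦X⟧ := PowerSeries.mk fun n => if a ∣ n then 1 else 0

theorem geomSeries_eq {a : ℕ} (ha : 1 ≤ a) : geomSeries a = 1 + X ^ a * geomSeries a := by
  ext n
  simp only [geomSeries, map_add, coeff_mk, coeff_X_pow_mul', coeff_one]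
  rcases Nat.eq_zero_or_pos n with rfl | hn
  · simp [show ¬ a ≤ 0 by omega]
  · by_cases han : a ≤ n
    · have : n ≤ a → a ∣ n := fun h => (le_antisymm h han) ▸ dvd_rfl
      have h2 : a ∣ n ∨ n ≤ a ↔ a ∣ n := ⟨fun h => h.elim id this, Or.inl⟩
      simp [han, hn.ne', Nat.dvd_sub_self_right, h2]
    · have : ¬ a ∣ n := fun h => han (Nat.le_of_dvd hn h)
      simp [han, hn.ne', this]

theorem geomSeries_abs (hq : ‖q‖ < 1) (a : ℕ) :
    Summable fun n => ‖coeff n (geomSeries a) * q ^ n‖ := by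
  refine Summable.of_nonneg_of_le (fun n => norm_nonneg _) (fun n => ?_)
    (summable_geometric_of_lt_one (norm_nonneg q) hq)
  simp only [geomSeries, coeff_mk, norm_mul, norm_pow]
  split_ifs <;> simp

theorem one_sub_pow_ne_zero (hq : ‖q‖ < 1) {a : ℕ} (ha : 1 ≤ a) : 1 - q ^ a ≠ 0 := by
  intro h
  have h1 : ‖q ^ a‖ < 1 := by
    rw [norm_pow]
    exact pow_lt_one₀ (norm_nonneg _) hq (by omega)
  rw [← sub_eq_zero.1 h, norm_one] at h1
  exact lt_irrefl _ h1

theorem geom (hq : ‖q‖ < 1) {a : ℕ} (ha : 1 ≤ a) :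
    AbsEval q (geomSeries a) (1 / (1 - q ^ a)) := by
  have h : AbsEval q (geomSeries a) _ := ⟨geomSeries_abs hq a, rfl⟩
  have h2 := one.add ((X_pow a).mul h)
  rw [← geomSeries_eq ha] at h2
  have h3 := h2.2.symm
  refine ⟨h.1, ?_⟩
  rw [eq_div_iff (one_sub_pow_ne_zero hq ha)]
  linear_combination -h3

/-- Solving formally for `f` gives `geomSeries a * g`, so convergence of `f` is a conclusion and
need not be assumed. -/
theorem of_eq_add_X_pow_mul (hq : ‖q‖ < 1) {a : ℕ} (ha : 1 ≤ a) (hg : AbsEval q g y)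
    (h : f = g + X ^ a * f) : AbsEval q f (y / (1 - q ^ a)) := by
  have e : f = geomSeries a * g := by
    have := geomSeries_eq ha
    linear_combination geomSeries a * h - f * this
  rw [e, div_eq_mul_one_div, mul_comm y]
  exact (geom hq ha).mul hg

end AbsEval

/-! ### Generating series of families of multisets -/

/-- The generating series, by sum, of the multisets of positive integers in `S`. -/
noncomputable def genSeries (S : Set (Multiset ℕ)) : ℂ⟦X⟧ :=
  PowerSeries.mk fun n => (({s | s ∈ S ∧ 0 ∉ s ∧ s.sum = n} : Set (Multiset ℕ)).ncard : ℂ)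

theorem finite_parts (n : ℕ) : ({s | 0 ∉ s ∧ s.sum = n} : Set (Multiset ℕ)).Finite := by
  refine (Set.finite_range fun π : n.Partition => π.parts).subset ?_
  rintro s ⟨h0, hs⟩
  exact ⟨⟨s, fun {i} hi => Nat.pos_of_ne_zero fun h => h0 (h ▸ hi), hs⟩, rfl⟩

theorem genSeries_union {S T : Set (Multiset ℕ)} (h : Disjoint S T) :
    genSeries (S ∪ T) = genSeries S + genSeries T := by
  ext n
  simp only [genSeries, map_add, coeff_mk]
  rw [← Nat.cast_add, ← Set.ncard_union_eq
    (h.mono (fun s hs => hs.1) (fun s hs => hs.1))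
    ((finite_parts n).subset fun s hs => hs.2) ((finite_parts n).subset fun s hs => hs.2)]
  refine congrArg (fun A : Set (Multiset ℕ) => (A.ncard : ℂ)) (Set.ext fun s => ?_)
  simp only [Set.mem_ofPred_eq, Set.mem_union]
  tauto

theorem genSeries_image {S : Set (Multiset ℕ)} {φ : Multiset ℕ → Multiset ℕ} {a : ℕ}
    (hφ : Function.Injective φ) (h0 : ∀ s ∈ S, 0 ∉ φ s ↔ 0 ∉ s)
    (hsum : ∀ s ∈ S, (φ s).sum = a + s.sum) : genSeries (φ '' S) = X ^ a * genSeries S := by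
  ext n
  rw [coeff_X_pow_mul']
  simp only [genSeries, coeff_mk]
  split_ifs with han
  · rw [← Set.ncard_image_of_injective {s | s ∈ S ∧ 0 ∉ s ∧ s.sum = n - a} hφ]
    refine congrArg (fun A : Set (Multiset ℕ) => (A.ncard : ℂ)) (Set.ext fun s => ?_)
    constructor
    · rintro ⟨⟨t, ht, rfl⟩, h1, h2⟩
      exact ⟨t, ⟨ht, (h0 t ht).1 h1, by have := hsum t ht; omega⟩, rfl⟩
    · rintro ⟨t, ⟨ht, h1, h2⟩, rfl⟩
      exact ⟨⟨t, ht, rfl⟩, (h0 t ht).2 h1, by have := hsum t ht; omega⟩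
  · rw [Nat.cast_eq_zero]
    convert Set.ncard_empty (Multiset ℕ)
    rw [Set.eq_empty_iff_forall_notMem]
    rintro _ ⟨⟨t, ht, rfl⟩, -, h2⟩
    have := hsum t ht
    omega

theorem genSeries_cons {S : Set (Multiset ℕ)} {a : ℕ} (ha : 1 ≤ a) :
    genSeries (Multiset.cons a '' S) = X ^ a * genSeries S :=
  genSeries_image (fun _ _ => (Multiset.cons_inj_right a).1)
    (fun s _ => by simp [Multiset.mem_cons, show ¬ 0 = a by omega])
    (fun s _ => by simp)

theorem genSeries_map_succ {S : Set (Multiset ℕ)} {p : ℕ} (h0 : ∀ s ∈ S, 0 ∉ s)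
    (hp : ∀ s ∈ S, s.card = p) :
    genSeries (Multiset.map (· + 1) '' S) = X ^ p * genSeries S :=
  genSeries_image (Multiset.map_injective (add_left_injective 1))
    (fun s hs => by simp [h0 s hs])
    (fun s hs => by rw [Multiset.sum_map_add]; simp [hp s hs, add_comm])

theorem genSeries_empty : genSeries ∅ = 0 := by
  ext n
  simp [genSeries]

theorem genSeries_singleton_zero : genSeries {0} = 1 := by
  ext n
  simp only [genSeries, coeff_mk, coeff_one]
  split_ifs with hn
  · have : {s : Multiset ℕ | s ∈ ({0} : Set (Multiset ℕ)) ∧ 0 ∉ s ∧ s.sum = n} = {0} := by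
      ext s
      simp only [Set.mem_ofPred_eq, Set.mem_singleton_iff]
      constructor
      · exact fun h => h.1
      · rintro rfl
        simp [hn]
    rw [this]
    simp
  · have : {s : Multiset ℕ | s ∈ ({0} : Set (Multiset ℕ)) ∧ 0 ∉ s ∧ s.sum = n} = ∅ := by
      rw [Set.eq_empty_iff_forall_notMem]
      rintro s ⟨rfl, -, h⟩
      exact hn (by simpa using h.symm)
    rw [this]
    simp

/-! ### A fixed number of parts, bounded below -/

/-- The multisets of `p` integers that are at least `c`. -/
def boundedBelow (p c : ℕ) : Set (Multiset ℕ) := {s | s.card = p ∧ ∀ x ∈ s, c ≤ x}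

/-- The sum of the generating series of `boundedBelow p c`. -/
noncomputable def boundedBelowSum (q : ℂ) (c : ℕ) : ℕ → ℂ
  | 0 => 1
  | p + 1 => q ^ c * boundedBelowSum q c p / (1 - q ^ (p + 1))

theorem boundedBelow_zero (c : ℕ) : boundedBelow 0 c = {0} := by
  ext s
  simp only [boundedBelow, Set.mem_ofPred_eq, Set.mem_singleton_iff, Multiset.card_eq_zero]
  constructor
  · exact fun h => h.1
  · rintro rfl
    simp

/-- The second family is the first shifted up by one in every part, a factor `X ^ (p + 1)`; this is
the source of the denominators in `boundedBelowSum`. -/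
theorem boundedBelow_succ (p c : ℕ) :
    boundedBelow (p + 1) c = Multiset.cons c '' boundedBelow p c ∪ boundedBelow (p + 1) (c + 1) := by
  ext s
  constructor
  · rintro ⟨h1, h2⟩
    by_cases hc : c ∈ s
    · obtain ⟨t, rfl⟩ := Multiset.exists_cons_of_mem hc
      exact Or.inl ⟨t, ⟨by simpa using h1, fun x hx => h2 x (Multiset.mem_cons_of_mem hx)⟩, rfl⟩
    · exact Or.inr ⟨h1, fun x hx => lt_of_le_of_ne (h2 x hx) fun h => hc (h ▸ hx)⟩
  · rintro (⟨t, ⟨h1, h2⟩, rfl⟩ | ⟨h1, h2⟩)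
    · refine ⟨by simp [h1], fun x hx => ?_⟩
      rcases Multiset.mem_cons.1 hx with rfl | hx
      · exact le_rfl
      · exact h2 x hx
    · exact ⟨h1, fun x hx => (Nat.lt_of_succ_le (h2 x hx)).le⟩

theorem map_succ_boundedBelow (p c : ℕ) :
    Multiset.map (· + 1) '' boundedBelow p c = boundedBelow p (c + 1) := by
  ext s
  constructor
  · rintro ⟨t, ⟨h1, h2⟩, rfl⟩
    refine ⟨by simp [h1], fun x hx => ?_⟩
    obtain ⟨y, hy, rfl⟩ := Multiset.mem_map.1 hx
    exact Nat.succ_le_succ (h2 y hy)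
  · rintro ⟨h1, h2⟩
    refine ⟨s.map (· - 1), ⟨by simp [h1], fun x hx => ?_⟩, ?_⟩
    · obtain ⟨y, hy, rfl⟩ := Multiset.mem_map.1 hx
      exact Nat.le_sub_one_of_lt (h2 y hy)
    · rw [Multiset.map_map]
      conv_rhs => rw [← Multiset.map_id s]
      refine Multiset.map_congr rfl fun x hx => ?_
      have := h2 x hx
      simp only [Function.comp, id]
      omega

theorem disjoint_cons_image {S T : Set (Multiset ℕ)} {a : ℕ} (h : ∀ s ∈ T, a ∉ s) :
    Disjoint (Multiset.cons a '' S) T := by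
  rw [Set.disjoint_left]
  rintro _ ⟨t, -, rfl⟩ ht
  exact h _ ht (Multiset.mem_cons_self a t)

variable {q : ℂ}

theorem absEval_boundedBelow (hq : ‖q‖ < 1) {c : ℕ} (hc : 1 ≤ c) (p : ℕ) :
    AbsEval q (genSeries (boundedBelow p c)) (boundedBelowSum q c p) := by
  induction p with
  | zero =>
    rw [boundedBelow_zero, genSeries_singleton_zero]
    exact AbsEval.one
  | succ p ih =>
    refine AbsEval.of_eq_add_X_pow_mul hq (Nat.succ_le_succ (Nat.zero_le p))
      ((AbsEval.X_pow c).mul ih) ?_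
    rw [← genSeries_map_succ (S := boundedBelow (p + 1) c)
      (fun s hs h0 => by have := hs.2 0 h0; omega) (fun s hs => hs.1), map_succ_boundedBelow,
      ← genSeries_cons hc, ← genSeries_union, ← boundedBelow_succ]
    exact disjoint_cons_image fun s hs h => absurd (hs.2 c h) (by omega)

/-! ### Parts to the right of the failing column -/

/-- The multisets of `p` integers that are at least `c`, of which at least `c + e + 1 - d` are at
least `d`, for `c < d ≤ c + e`. -/
def topSet (e p c : ℕ) : Set (Multiset ℕ) :=
  {s | s.card = p ∧ (∀ x ∈ s, c ≤ x) ∧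
    ∀ d, c < d → d ≤ c + e → c + e + 1 ≤ d + s.countP (d ≤ ·)}

/-- The sum of the generating series of `topSet e p c`. -/
noncomputable def topSum (q : ℂ) : ℕ → ℕ → ℕ → ℂ
  | 0, p, c => boundedBelowSum q c p
  | _ + 1, 0, _ => 0
  | e + 1, p + 1, c =>
    q ^ c * topSum q (e + 1) p c + if e ≤ p then topSum q e (p + 1) (c + 1) else 0

theorem topSet_zero (p c : ℕ) : topSet 0 p c = boundedBelow p c := by
  ext s
  simp only [topSet, boundedBelow, Set.mem_ofPred_eq]
  exact ⟨fun h => ⟨h.1, h.2.1⟩, fun h => ⟨h.1, h.2, fun d h1 h2 => by omega⟩⟩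

theorem topSet_eq_empty {e p c : ℕ} (h : p < e) : topSet e p c = ∅ := by
  rw [Set.eq_empty_iff_forall_notMem]
  rintro s ⟨h1, -, h3⟩
  have h4 := h3 (c + 1) (by omega) (by omega)
  have h5 := Multiset.countP_le_card (c + 1 ≤ ·) s
  omega

/-- A copy of `c` counts towards no threshold `d > c` and can be removed freely. Without one, the
lower bound rises and the threshold `d = c + 1` becomes automatic. -/
theorem topSet_succ {e p : ℕ} (c : ℕ) (he : e ≤ p) : topSet (e + 1) (p + 1) c =
    Multiset.cons c '' topSet (e + 1) p c ∪ topSet e (p + 1) (c + 1) := by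
  ext s
  constructor
  · rintro ⟨h1, h2, h3⟩
    by_cases hc : c ∈ s
    · obtain ⟨t, rfl⟩ := Multiset.exists_cons_of_mem hc
      refine Or.inl ⟨t, ⟨by simpa using h1, fun x hx => h2 x (Multiset.mem_cons_of_mem hx),
        fun d hd hd' => ?_⟩, rfl⟩
      have := h3 d hd hd'
      rwa [Multiset.countP_cons_of_neg _ (by omega)] at this
    · refine Or.inr ⟨h1, fun x hx => lt_of_le_of_ne (h2 x hx) fun h => hc (h ▸ hx),
        fun d hd hd' => ?_⟩
      have := h3 d (by omega) (by omega)
      omega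
  · rintro (⟨t, ⟨h1, h2, h3⟩, rfl⟩ | ⟨h1, h2, h3⟩)
    · refine ⟨by simp [h1], fun x hx => ?_, fun d hd hd' => ?_⟩
      · rcases Multiset.mem_cons.1 hx with rfl | hx
        · exact le_rfl
        · exact h2 x hx
      · rw [Multiset.countP_cons_of_neg _ (by omega)]
        exact h3 d hd hd'
    · refine ⟨h1, fun x hx => (Nat.lt_of_succ_le (h2 x hx)).le, fun d hd hd' => ?_⟩
      rcases Nat.lt_or_ge (c + 1) d with h | h
      · have := h3 d h (by omega)
        omega
      · obtain rfl : d = c + 1 := by omega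
        -- All `p + 1` elements reach this threshold, which requires `e + 1` of them: this is where
        -- `e ≤ p` enters.
        rw [Multiset.countP_eq_card.2 h2, h1]
        omega

theorem absEval_topSet (hq : ‖q‖ < 1) (e p : ℕ) : ∀ {c : ℕ}, 1 ≤ c →
    AbsEval q (genSeries (topSet e p c)) (topSum q e p c) := by
  induction e generalizing p with
  | zero =>
    intro c hc
    rw [topSet_zero, topSum]
    exact absEval_boundedBelow hq hc p
  | succ e ihe =>
    intro c hc
    induction p with
    | zero =>
      rw [topSet_eq_empty (Nat.succ_pos e), genSeries_empty, topSum]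
      exact AbsEval.zero
    | succ p ihp =>
      rw [topSum]
      split_ifs with he
      · rw [topSet_succ c he, genSeries_union, genSeries_cons hc]
        · exact ((AbsEval.X_pow c).mul ihp).add (ihe (p + 1) (by omega))
        · exact disjoint_cons_image fun s hs h => absurd (hs.2.1 c h) (by omega)
      -- The first summand of `topSum` carries no guard; it is harmless because it evaluates the
      -- series of an empty family.
      · have h := (AbsEval.X_pow c).mul ihp
        rw [topSet_eq_empty (by omega : p < e + 1), genSeries_empty, mul_zero] at h
        rw [topSet_eq_empty (by omega), genSeries_empty, add_zero]
        exact h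

/-! ### Parts to the left of the failing column -/

/-- The multisets of positive integers whose elements above `m` form a multiset in `T`, whose other
elements are at most `a`, and in which at least `j + 1 - c` elements lie in `[c, m]`, for
`1 ≤ c ≤ j`. -/
def stackedSet (T : Set (Multiset ℕ)) (m j a : ℕ) : Set (Multiset ℕ) :=
  {s | s.filter (m < ·) ∈ T ∧ (∀ x ∈ s, 1 ≤ x ∧ (x ≤ m → x ≤ a)) ∧
    ∀ c, 1 ≤ c → c ≤ j → j + 1 ≤ c + s.countP fun x => c ≤ x ∧ x ≤ m}

/-- The sum of the generating series of `stackedSet T m j a`, when that of `T` has sum `x`. -/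
noncomputable def stackedSum (q x : ℂ) : ℕ → ℕ → ℂ
  | 0, 0 => x
  | 0, a + 1 => stackedSum q x 0 a / (1 - q ^ (a + 1))
  | _ + 1, 0 => 0
  | j + 1, a + 1 => if j ≤ a then
      q ^ (a + 1) * stackedSum q x j (a + 1) + stackedSum q x (j + 1) a else 0

variable {T : Set (Multiset ℕ)} {m : ℕ}

theorem stackedSet_eq_empty {j a : ℕ} (h : a < j) : stackedSet T m j a = ∅ := by
  rw [Set.eq_empty_iff_forall_notMem]
  rintro s ⟨-, h2, h3⟩
  have h4 := h3 j (by omega) le_rfl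
  rw [Multiset.countP_eq_zero.2] at h4
  · omega
  · rintro x hx ⟨h5, h6⟩
    have := (h2 x hx).2 h6
    omega

theorem stackedSet_zero_zero (hT : ∀ s ∈ T, ∀ x ∈ s, m < x) : stackedSet T m 0 0 = T := by
  ext s
  constructor
  · rintro ⟨h1, h2, -⟩
    rwa [Multiset.filter_eq_self.2] at h1
    intro x hx
    have := h2 x hx
    omega
  · intro hs
    refine ⟨?_, fun x hx => ?_, fun c h1 h2 => by omega⟩
    · rwa [Multiset.filter_eq_self.2 (hT s hs)]
    · have := hT s hs x hx
      omega

theorem stackedSet_notMem {s : Multiset ℕ} {j a : ℕ} (ha : a + 1 ≤ m)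
    (h : s ∈ stackedSet T m j a) : a + 1 ∉ s := fun hs => by
  have := (h.2.1 _ hs).2 ha
  omega

theorem mem_stackedSet_succ {s : Multiset ℕ} {j a : ℕ} (hs : a + 1 ∉ s) :
    s ∈ stackedSet T m j (a + 1) ↔ s ∈ stackedSet T m j a := by
  refine and_congr_right fun _ => and_congr_left fun _ => ?_
  refine forall₂_congr fun x hx => and_congr_right fun _ => forall_congr' fun _ => ?_
  have : x ≠ a + 1 := fun h => hs (h ▸ hx)
  omega

/-- With no count required, copies of `a + 1` are unlimited, which yields a geometric factor. -/
theorem stackedSet_zero_succ {a : ℕ} (ha : a + 1 ≤ m) : stackedSet T m 0 (a + 1) =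
    stackedSet T m 0 a ∪ Multiset.cons (a + 1) '' stackedSet T m 0 (a + 1) := by
  ext s
  by_cases hs : a + 1 ∈ s
  · obtain ⟨t, rfl⟩ := Multiset.exists_cons_of_mem hs
    have h1 : (a + 1) ::ₘ t ∉ stackedSet T m 0 a := fun h => stackedSet_notMem ha h hs
    rw [Set.mem_union, or_iff_right h1,
      Function.Injective.mem_set_image fun _ _ => (Multiset.cons_inj_right (a + 1)).1]
    simp only [stackedSet, Set.mem_ofPred_eq, Multiset.mem_cons, forall_eq_or_imp,
      Multiset.filter_cons_of_neg t (show ¬ m < a + 1 by omega)]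
    refine and_congr_right fun _ => ?_
    refine and_congr ?_ ?_
    · simp
    · exact ⟨fun _ c h1 h2 => by omega, fun _ c h1 h2 => by omega⟩
  · rw [mem_stackedSet_succ hs, Set.mem_union, or_iff_left]
    rintro ⟨t, -, rfl⟩
    exact hs (Multiset.mem_cons_self _ _)

/-- Since `j ≤ a`, a copy of `a + 1` counts towards every threshold `c ≤ j + 1`; removing it lowers
all requirements by one, that is, `j + 1` to `j`. -/
theorem stackedSet_succ_succ {j a : ℕ} (ha : a + 1 ≤ m) (hj : j ≤ a) :
    stackedSet T m (j + 1) (a + 1) =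
      Multiset.cons (a + 1) '' stackedSet T m j (a + 1) ∪ stackedSet T m (j + 1) a := by
  ext s
  by_cases hs : a + 1 ∈ s
  · obtain ⟨t, rfl⟩ := Multiset.exists_cons_of_mem hs
    have h1 : (a + 1) ::ₘ t ∉ stackedSet T m (j + 1) a := fun h => stackedSet_notMem ha h hs
    rw [Set.mem_union, or_iff_left h1,
      Function.Injective.mem_set_image fun _ _ => (Multiset.cons_inj_right (a + 1)).1]
    simp only [stackedSet, Set.mem_ofPred_eq, Multiset.mem_cons, forall_eq_or_imp,
      Multiset.filter_cons_of_neg t (show ¬ m < a + 1 by omega)]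
    refine and_congr_right fun _ => and_congr (by simp) ?_
    constructor
    · intro h c h1 h2
      have := h c h1 (by omega)
      rw [Multiset.countP_cons_of_pos _ (by omega)] at this
      omega
    · intro h c h1 h2
      rw [Multiset.countP_cons_of_pos _ (by omega)]
      -- The threshold `c = j + 1` asks for a single element, and `a + 1` is one.
      rcases Nat.lt_or_ge j c with h3 | h3
      · omega
      · have := h c h1 h3
        omega
  · rw [mem_stackedSet_succ hs, Set.mem_union, or_iff_right]
    rintro ⟨t, -, rfl⟩
    exact hs (Multiset.mem_cons_self _ _)

theorem absEval_stackedSet (hq : ‖q‖ < 1) (hT : ∀ s ∈ T, ∀ x ∈ s, m < x) {x : ℂ}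
    (hx : AbsEval q (genSeries T) x) (j : ℕ) : ∀ {a : ℕ}, a ≤ m →
    AbsEval q (genSeries (stackedSet T m j a)) (stackedSum q x j a) := by
  induction j with
  | zero =>
    intro a ha
    induction a with
    | zero =>
      rw [stackedSet_zero_zero hT, stackedSum]
      exact hx
    | succ a ih =>
      rw [stackedSum]
      refine AbsEval.of_eq_add_X_pow_mul hq (by omega) (ih (by omega)) ?_
      rw [← genSeries_cons (by omega), ← genSeries_union, ← stackedSet_zero_succ ha]
      exact (disjoint_cons_image fun s hs => stackedSet_notMem ha hs).symm
  | succ j ihj =>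
    intro a ha
    induction a with
    | zero =>
      rw [stackedSet_eq_empty (Nat.succ_pos j), genSeries_empty, stackedSum]
      exact AbsEval.zero
    | succ a ih =>
      rw [stackedSum]
      split_ifs with hja
      · rw [stackedSet_succ_succ ha hja, genSeries_union, genSeries_cons (by omega)]
        · exact ((AbsEval.X_pow _).mul (ihj ha)).add (ih (by omega))
        · exact disjoint_cons_image fun s hs => stackedSet_notMem ha hs
      · rw [stackedSet_eq_empty (by omega), genSeries_empty]
        exact AbsEval.zero

/-! ### Decomposition by the last failing column -/

/-- The triangle of size `k` fits into the partition with parts `s`. -/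
def ContainsTriangle (k : ℕ) (s : Multiset ℕ) : Prop :=
  ∀ c, 1 ≤ c → c ≤ k → k + 1 ≤ c + s.countP (c ≤ ·)

/-- The partitions with a Durfee triangle of size `k`. -/
def durfeeSet (k : ℕ) : Set (Multiset ℕ) :=
  {s | (∀ x ∈ s, 1 ≤ x) ∧ ContainsTriangle k s ∧ ¬ ContainsTriangle (k + 1) s}

/-- The partitions with a Durfee triangle of size `k` for which `m + 1` is the largest `c` such that
the triangle of size `k + 1` meets column `c` of the diagram in too few nodes. -/
def durfeeLayer (k m : ℕ) : Set (Multiset ℕ) :=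
  {s | (∀ x ∈ s, 1 ≤ x) ∧ (∀ c, 1 ≤ c → c ≤ m → k + 1 ≤ c + s.countP (c ≤ ·)) ∧
    m + 1 + s.countP (m + 1 ≤ ·) = k + 1 ∧
    ∀ d, m + 1 < d → d ≤ k + 1 → k + 2 ≤ d + s.countP (d ≤ ·)}

theorem mem_durfeeSet_iff {k : ℕ} {s : Multiset ℕ} :
    s ∈ durfeeSet k ↔ ∃ m < k + 1, s ∈ durfeeLayer k m := by
  constructor
  · rintro ⟨h1, h2, h3⟩
    have h4 : ∃ m ≤ k, m + 1 + s.countP (m + 1 ≤ ·) ≤ k + 1 := by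
      simp only [ContainsTriangle] at h3
      push Not at h3
      obtain ⟨c, hc, hc', h⟩ := h3
      obtain ⟨m, rfl⟩ : ∃ m, c = m + 1 := ⟨c - 1, by omega⟩
      exact ⟨m, by omega, by omega⟩
    obtain ⟨m₀, hm₀, h5⟩ := h4
    let P : ℕ → Prop := fun m => m + 1 + s.countP (m + 1 ≤ ·) ≤ k + 1
    obtain ⟨hle, hP, hmax⟩ : Nat.findGreatest P k ≤ k ∧ P (Nat.findGreatest P k) ∧
        ∀ d, Nat.findGreatest P k < d → d ≤ k → ¬ P d :=
      ⟨Nat.findGreatest_le k, Nat.findGreatest_spec (P := P) hm₀ h5,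
        fun d hd hd' => Nat.findGreatest_is_greatest hd hd'⟩
    generalize Nat.findGreatest P k = m at hle hP hmax
    refine ⟨m, by omega, h1, fun c hc hc' => h2 c hc (by omega), ?_, fun d hd hd' => ?_⟩
    · refine le_antisymm hP ?_
      -- The triangle of size `k` forces the deficit to be exactly one node; for `m = k` its column
      -- is empty and the bound is trivial.
      rcases hle.lt_or_eq with h | h
      · exact h2 (m + 1) (by omega) h
      · omega
    · obtain ⟨e, rfl⟩ : ∃ e, d = e + 1 := ⟨d - 1, by omega⟩
      have := hmax e (by omega) (by omega)
      simp only [P] at this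
      omega
  · rintro ⟨m, hm, h1, h2, h3, h4⟩
    refine ⟨h1, fun c hc hc' => ?_, fun h => ?_⟩
    · rcases lt_trichotomy c (m + 1) with h | rfl | h
      · exact h2 c hc (by omega)
      · omega
      · have := h4 c h (by omega)
        omega
    · have := h (m + 1) (by omega) (by omega)
      omega

theorem countP_filter_lt (s : Multiset ℕ) {m d : ℕ} (h : m < d) :
    (s.filter (m < ·)).countP (d ≤ ·) = s.countP (d ≤ ·) := by
  rw [Multiset.countP_filter]
  exact Multiset.countP_congr rfl fun x _ => by simp; omega

theorem card_filter_lt (s : Multiset ℕ) (m : ℕ) :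
    (s.filter (m < ·)).card = s.countP (m + 1 ≤ ·) :=
  (Multiset.countP_eq_card_filter _ _).symm

theorem countP_Icc_add (s : Multiset ℕ) {c m : ℕ} (h : c ≤ m) :
    s.countP (fun x => c ≤ x ∧ x ≤ m) + s.countP (m + 1 ≤ ·) = s.countP (c ≤ ·) := by
  induction s using Multiset.induction_on with
  | empty => simp
  | cons a s ih =>
    simp only [Multiset.countP_cons]
    split_ifs <;> omega

/-- Counts at thresholds above `m` see only the parts above `m`. At a threshold `c ≤ m` those parts
contribute the fixed number `k - m`, leaving `m + 1 - c` to the small parts. -/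
theorem durfeeLayer_eq {k m : ℕ} (hm : m ≤ k) :
    durfeeLayer k m = stackedSet (topSet (k - m - 1) (k - m) (m + 2)) m m m := by
  ext s
  simp only [durfeeLayer, stackedSet, topSet, Set.mem_ofPred_eq, card_filter_lt]
  constructor
  · rintro ⟨h1, h2, h3, h4⟩
    refine ⟨⟨by omega, ?_, fun d hd hd' => ?_⟩, fun x hx => ⟨h1 x hx, id⟩, fun c hc hc' => ?_⟩
    · have h5 : (s.filter (m < ·)).countP (m + 2 ≤ ·) = (s.filter (m < ·)).card := by
        refine le_antisymm (Multiset.countP_le_card _ _) ?_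
        rw [countP_filter_lt s (by omega), card_filter_lt]
        -- For `m < k`, column `m + 2` is as long as column `m + 1`, so no part equals `m + 1`; for
        -- `m = k` there are no parts above `m`.
        rcases hm.lt_or_eq with h | h
        · have := h4 (m + 2) (by omega) (by omega)
          omega
        · omega
      exact Multiset.countP_eq_card.1 h5
    · rw [countP_filter_lt s (by omega)]
      have := h4 d (by omega) (by omega)
      omega
    · have := h2 c hc hc'
      have := countP_Icc_add s hc'
      omega
  · rintro ⟨⟨h1, h2, h3⟩, h4, h5⟩
    refine ⟨fun x hx => (h4 x hx).1, fun c hc hc' => ?_, by omega, fun d hd hd' => ?_⟩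
    · have := h5 c hc hc'
      have := countP_Icc_add s hc'
      omega
    · rcases Nat.lt_or_ge (m + 2) d with h | h
      · have := h3 d h (by omega)
        rw [countP_filter_lt s (by omega)] at this
        omega
      · obtain rfl : d = m + 2 := by omega
        have h6 := Multiset.countP_eq_card.2 h2
        rw [countP_filter_lt s (by omega), card_filter_lt] at h6
        omega

/-- The sum of the generating series of the first `M` layers of `durfeeSet k`. -/
noncomputable def layerSum (q : ℂ) (k M : ℕ) : ℂ :=
  ∑ m ∈ Finset.range M, stackedSum q (topSum q (k - m - 1) (k - m) (m + 2)) m m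

theorem absEval_durfeeLayer (hq : ‖q‖ < 1) {k m : ℕ} (hm : m ≤ k) :
    AbsEval q (genSeries (durfeeLayer k m))
      (stackedSum q (topSum q (k - m - 1) (k - m) (m + 2)) m m) := by
  rw [durfeeLayer_eq hm]
  refine absEval_stackedSet hq (fun s hs x hx => ?_) (absEval_topSet hq _ _ (by omega)) m le_rfl
  have := hs.2.1 x hx
  omega

theorem absEval_layers (hq : ‖q‖ < 1) (k : ℕ) : ∀ M ≤ k + 1,
    AbsEval q (genSeries {s | ∃ m < M, s ∈ durfeeLayer k m}) (layerSum q k M) := by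
  intro M
  induction M with
  | zero =>
    intro _
    have : {s | ∃ m < 0, s ∈ durfeeLayer k m} = ∅ := by
      rw [Set.eq_empty_iff_forall_notMem]
      rintro s ⟨m, hm, -⟩
      omega
    rw [this, genSeries_empty, layerSum, Finset.range_zero, Finset.sum_empty]
    exact AbsEval.zero
  | succ M ih =>
    intro hM
    have : {s | ∃ m < M + 1, s ∈ durfeeLayer k m} =
        {s | ∃ m < M, s ∈ durfeeLayer k m} ∪ durfeeLayer k M := by
      ext s
      constructor
      · rintro ⟨m, hm, h⟩
        rcases (Nat.lt_succ_iff.1 hm).lt_or_eq with h' | rfl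
        · exact Or.inl ⟨m, h', h⟩
        · exact Or.inr h
      · rintro (⟨m, hm, h⟩ | h)
        · exact ⟨m, by omega, h⟩
        · exact ⟨M, by omega, h⟩
    rw [this, genSeries_union, layerSum, Finset.sum_range_succ]
    · exact (ih (by omega)).add (absEval_durfeeLayer hq (by omega))
    · rw [Set.disjoint_left]
      rintro s ⟨m, hm, h⟩ h'
      -- Column `M + 1` is long enough in an earlier layer but too short in layer `M`.
      have h1 := h.2.2.2 (M + 1) (by omega) hM
      have h2 := h'.2.2.1
      omega

theorem absEval_durfeeSet (hq : ‖q‖ < 1) (k : ℕ) :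
    AbsEval q (genSeries (durfeeSet k)) (layerSum q k (k + 1)) := by
  have : durfeeSet k = {s | ∃ m < k + 1, s ∈ durfeeLayer k m} :=
    Set.ext fun s => mem_durfeeSet_iff
  rw [this]
  exact absEval_layers hq k (k + 1) le_rfl

/-! ### Coefficients, and the closed form for size five -/

theorem coeff_genSeries (S : Set (Multiset ℕ)) [DecidablePred (· ∈ S)] (n : ℕ) :
    coeff n (genSeries S) =
      ((Finset.univ.filter fun π : n.Partition => π.parts ∈ S).card : ℂ) := by
  simp only [genSeries, coeff_mk]
  rw [← Set.ncard_coe_finset, ← Set.ncard_image_of_injective (f := fun π : n.Partition => π.parts) _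
    fun a b h => Nat.Partition.ext h]
  refine congrArg (fun A : Set (Multiset ℕ) => (A.ncard : ℂ)) (Set.ext fun s => ?_)
  constructor
  · rintro ⟨h1, h2, h3⟩
    exact ⟨⟨s, fun {i} hi => Nat.pos_of_ne_zero fun h => h2 (h ▸ hi), h3⟩, by simpa using h1, rfl⟩
  · rintro ⟨π, h, rfl⟩
    exact ⟨by simpa using h, fun h0 => (π.parts_pos h0).ne' rfl, π.parts_sum⟩

theorem layerSum_five (hq : ‖q‖ < 1) : layerSum q 5 6 = rationalF5 q := by
  have h1 : 1 - q ≠ 0 := by simpa using AbsEval.one_sub_pow_ne_zero hq (le_refl 1)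
  have h2 := AbsEval.one_sub_pow_ne_zero hq (show 1 ≤ 2 by omega)
  have h3 := AbsEval.one_sub_pow_ne_zero hq (show 1 ≤ 3 by omega)
  have h4 := AbsEval.one_sub_pow_ne_zero hq (show 1 ≤ 4 by omega)
  have h5 := AbsEval.one_sub_pow_ne_zero hq (show 1 ≤ 5 by omega)
  simp [layerSum, Finset.sum_range_succ, stackedSum, topSum, boundedBelowSum, rationalF5]
  field_simp
  ring

/-! ### Ferrers boards and triangles -/

theorem lt_countP_iff_of_pairwise_ge {l : List ℕ} (hl : l.Pairwise (· ≥ ·)) (c i : ℕ) :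
    i < l.countP (c ≤ ·) ↔ ∃ h : i < l.length, c ≤ l[i] := by
  induction l generalizing i with
  | nil => simp
  | cons a l ih =>
    rw [List.pairwise_cons] at hl
    rw [List.countP_cons]
    by_cases ha : c ≤ a
    · cases i with
      | zero => simp [ha]
      | succ i => simpa [ha] using ih hl.2 i
    · have h0 : l.countP (c ≤ ·) = 0 := by
        rw [List.countP_eq_zero]
        intro x hx
        have := hl.1 x hx
        simp only [decide_eq_true_eq]
        omega
      simp only [h0, ha, decide_false, Bool.false_eq_true, if_false, add_zero, Nat.not_lt_zero,
        false_iff, not_exists, not_le]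
      intro h
      cases i with
      | zero => simpa using ha
      | succ i =>
        have := hl.1 _ (List.getElem_mem (Nat.lt_of_succ_lt_succ h))
        simp only [List.getElem_cons_succ]
        omega

variable {n : ℕ} {π : n.Partition}

theorem mem_ferrersBoard {i j : ℕ} :
    (i, j) ∈ ferrersBoard π ↔ i < π.parts.countP (j + 1 ≤ ·) := by
  have h := lt_countP_iff_of_pairwise_ge (Multiset.pairwise_sort π.parts (· ≥ ·)) (j + 1) i
  rw [← Multiset.coe_countP, Multiset.sort_eq] at h
  rw [h, ferrersBoard, YoungDiagram.mem_ofRowLens]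
  rfl

theorem triangle_subset_iff {k : ℕ} :
    triangle k ⊆ (ferrersBoard π).cells ↔ ContainsTriangle k π.parts := by
  constructor
  · intro h c hc hc'
    have := h (show (k - c, c - 1) ∈ triangle k by
      simp only [triangle, Finset.mem_filter, Finset.mem_product, Finset.mem_range]
      omega)
    rw [YoungDiagram.mem_cells, mem_ferrersBoard, Nat.sub_add_cancel hc] at this
    omega
  · rintro h ⟨i, j⟩ hij
    simp only [triangle, Finset.mem_filter, Finset.mem_product, Finset.mem_range] at hij
    rw [YoungDiagram.mem_cells, mem_ferrersBoard]
    have := h (j + 1) (by omega) (by omega)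
    omega

theorem ContainsTriangle.le {k : ℕ} (h : ContainsTriangle k π.parts) : k ≤ n := by
  rcases Nat.eq_zero_or_pos k with rfl | hk
  · exact Nat.zero_le n
  · have h1 := h 1 le_rfl hk
    have h2 := Multiset.countP_le_card (1 ≤ ·) π.parts
    have h3 : π.parts.card ≤ π.parts.sum := by
      have := Multiset.card_nsmul_le_sum (s := π.parts) (a := 1) fun x hx => π.parts_pos hx
      simpa using this
    rw [π.parts_sum] at h3
    omega

theorem ContainsTriangle.mono {k l : ℕ} {s : Multiset ℕ} (h : ContainsTriangle l s) (hk : k ≤ l) :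
    ContainsTriangle k s := fun c hc hc' => by
  have := h c hc (by omega)
  omega

theorem le_durfeeTriangleSize_iff {k : ℕ} :
    k ≤ durfeeTriangleSize π ↔ ContainsTriangle k π.parts := by
  constructor
  · intro h
    have h0 : triangle 0 ⊆ (ferrersBoard π).cells := by
      simp [triangle]
    have h1 : triangle (durfeeTriangleSize π) ⊆ (ferrersBoard π).cells :=
      Nat.findGreatest_spec (P := fun k => triangle k ⊆ (ferrersBoard π).cells) (Nat.zero_le n) h0
    exact (triangle_subset_iff.1 h1).mono h
  · intro h
    exact Nat.le_findGreatest h.le (triangle_subset_iff.2 h)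

/-! ### Rooks and the Durfee triangle -/

theorem card_le_of_fst_lt_or_snd_lt {S : Finset (ℕ × ℕ)} {i j : ℕ} (hS : NonIntersecting S)
    (h : ∀ a ∈ S, a.1 < i ∨ a.2 < j) : S.card ≤ i + j := by
  have hu : S = S.filter (fun a => a.1 < i) ∪ S.filter (fun a => a.2 < j) := by
    ext a
    simp only [Finset.mem_union, Finset.mem_filter]
    have := h a
    tauto
  have h1 : (S.filter fun a => a.1 < i).card ≤ (Finset.range i).card := by
    refine Finset.card_le_card_of_injOn Prod.fst (fun a ha => ?_) fun a ha b hb hab => ?_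
    · simpa using (Finset.mem_filter.1 ha).2
    · by_contra hne
      exact (hS a (Finset.mem_filter.1 ha).1 b (Finset.mem_filter.1 hb).1 hne).1 hab
  have h2 : (S.filter fun a => a.2 < j).card ≤ (Finset.range j).card := by
    refine Finset.card_le_card_of_injOn Prod.snd (fun a ha => ?_) fun a ha b hb hab => ?_
    · simpa using (Finset.mem_filter.1 ha).2
    · by_contra hne
      exact (hS a (Finset.mem_filter.1 ha).1 b (Finset.mem_filter.1 hb).1 hne).2 hab
  rw [Finset.card_range] at h1 h2
  rw [hu]
  exact (Finset.card_union_le _ _).trans (Nat.add_le_add h1 h2)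

theorem le_maxRook_iff {k : ℕ} : k ≤ maxRook π ↔ ContainsTriangle k π.parts := by
  constructor
  · intro hk c hc hc'
    by_contra hlt
    -- If the hypotenuse square `(k - c, c - 1)` is missing, every board square lies in the first `k
    -- - c` rows or the first `c - 1` columns, which hold at most `k - 1` rooks.
    have hle : maxRook π ≤ (k - c) + (c - 1) := by
      refine Finset.sup_le fun S hS => ?_
      rw [Finset.mem_filter, Finset.mem_powerset] at hS
      refine card_le_of_fst_lt_or_snd_lt hS.2 fun a ha => ?_
      by_contra hcon
      have h1 := (ferrersBoard π).up_left_mem (i1 := k - c) (j1 := c - 1) (i2 := a.1) (j2 := a.2)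
        (by omega) (by omega) (hS.1 ha)
      rw [mem_ferrersBoard, Nat.sub_add_cancel hc] at h1
      omega
    omega
  · intro h
    -- The hypotenuse of the triangle.
    let S : Finset (ℕ × ℕ) := (Finset.range k).image fun i => (i, k - 1 - i)
    have hcard : S.card = k := by
      rw [Finset.card_image_of_injective _ fun a b hab => (Prod.ext_iff.1 hab).1, Finset.card_range]
    have hmem : S ∈ (ferrersBoard π).cells.powerset.filter fun S => NonIntersecting S := by
      rw [Finset.mem_filter, Finset.mem_powerset]
      refine ⟨fun a ha => triangle_subset_iff.2 h ?_, fun a ha b hb hab => ?_⟩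
      · obtain ⟨i, hi, rfl⟩ := Finset.mem_image.1 ha
        simp only [triangle, Finset.mem_filter, Finset.mem_product, Finset.mem_range] at hi ⊢
        omega
      · obtain ⟨i, hi, rfl⟩ := Finset.mem_image.1 ha
        obtain ⟨j, hj, rfl⟩ := Finset.mem_image.1 hb
        rw [Finset.mem_range] at hi hj
        have hij : i ≠ j := fun h => hab (by rw [h])
        exact ⟨hij, by simp only; omega⟩
    have := Finset.le_sup (f := Finset.card) hmem
    rwa [hcard] at this

theorem maxRook_eq_durfeeTriangleSize (π : n.Partition) : maxRook π = durfeeTriangleSize π :=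
  eq_of_forall_le_iff fun _ => le_maxRook_iff.trans le_durfeeTriangleSize_iff.symm

theorem rookCount_eq_durfeeCount (k n : ℕ) : rookCount k n = durfeeCount k n := by
  simp only [rookCount, durfeeCount, maxRook_eq_durfeeTriangleSize]

/-! ### Passage to the counting series -/

theorem parts_mem_durfeeSet {k : ℕ} : π.parts ∈ durfeeSet k ↔ durfeeTriangleSize π = k := by
  have h1 := le_durfeeTriangleSize_iff (π := π) (k := k)
  have h2 := le_durfeeTriangleSize_iff (π := π) (k := k + 1)
  simp only [durfeeSet, Set.mem_ofPred_eq, ← h1, ← h2]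
  constructor
  · rintro ⟨-, h3, h4⟩
    omega
  · rintro rfl
    exact ⟨fun x hx => π.parts_pos hx, le_rfl, by omega⟩

theorem coeff_durfeeSet (k n : ℕ) :
    PowerSeries.coeff n (genSeries (durfeeSet k)) = (durfeeCount k n : ℂ) := by
  classical
  rw [coeff_genSeries, durfeeCount]
  simp only [parts_mem_durfeeSet]

theorem durfeeCount_eq_zero {k n : ℕ} (h : n < k) : durfeeCount k n = 0 := by
  rw [durfeeCount, Finset.card_eq_zero, Finset.filter_eq_empty_iff]
  rintro π - hπ
  have := (le_durfeeTriangleSize_iff.1 hπ.ge).le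
  omega

theorem hasSum_durfeeCount_five {q : ℂ} (hq : ‖q‖ < 1) :
    HasSum (fun n : ℕ => (durfeeCount 5 (n + 1) : ℂ) * q ^ (n + 1)) (rationalF5 q) := by
  have h := (absEval_durfeeSet hq 5).hasSum
  rw [layerSum_five hq] at h
  simp only [coeff_durfeeSet] at h
  -- Drops the term `n = 0`, which vanishes because `0 < 5`.
  rw [← hasSum_nat_add_iff' 1] at h
  simpa [durfeeCount_eq_zero] using h

end RookPartition

/-- The sums run over `n ≥ 1`, written as `n + 1` with `n ≥ 0`. -/
theorem theorem3p5 (q : ℂ) (hq : ‖q‖ < 1) :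
    HasSum (fun n : ℕ => (RookPartition.rookCount 5 (n + 1) : ℂ) * q ^ (n + 1))
      (RookPartition.rationalF5 q) ∧
    HasSum (fun n : ℕ => (RookPartition.durfeeCount 5 (n + 1) : ℂ) * q ^ (n + 1))
      (RookPartition.rationalF5 q) := by
  simp only [RookPartition.rookCount_eq_durfeeCount, and_self]
  exact RookPartition.hasSum_durfeeCount_five hq
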